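/- Let $(B^n,g_B)$ be a compact connected Riemannian manifold (without boundary), let $(F^d,g_F)$, $d\ge 1$, be a semi-Riemannian manifold (without boundary) whose scalar curvature is constant, $S_F=\lambda_F$, and let $f\in C^\infty(B)$ be positive. Let $\overline M^{n+d}=B\times_f F$ be the warped product, i.e. the manifold $B\times F$ with the metric $$\overline g=\pi^*g_B+(f\circ\pi)^2\,\sigma^*g_F,$$ where $\pi:B\times F\to B$ and $\sigma:B\times F\to F$ are the projections. Suppose that there are $h\in C^\infty(B)$ and $\rho\in\mathbb R$ such that $\overline M^{n+d}$ is a gradient Yamabe soliton with potential function $\widetilde h=h\circ\pi$ and soliton constant $\rho$, that is, $$(S_{\overline g}-\rho)\,\overline g=\mathrm{Hess}_{\overline g}(\widetilde h),$$ where $S_{\overline g}$ is the scalar curvature of $\overline g$. Then the soliton is trivial: $h$ (equivalently, the potential function $\widetilde h$) is constant. -/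

import Mathlib

open Bundle Manifold ContDiff Set

noncomputable section

/-! ### Symmetric bilinear tensor fields and pull-back -/

section Pullback

variable {E : Type*} [NormedAddCommGroup E] [NormedSpace ℝ E]
  {H : Type*} [TopologicalSpace H] (I : ModelWithCorners ℝ E H)
  {M : Type*} [TopologicalSpace M] [ChartedSpace H M]
  {E' : Type*} [NormedAddCommGroup E'] [NormedSpace ℝ E']
  {H' : Type*} [TopologicalSpace H'] (I' : ModelWithCorners ℝ E' H')
  {N : Type*} [TopologicalSpace N] [ChartedSpace H' N]

/-- A field of continuous bilinear forms on the tangent spaces of `M`. -/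
abbrev BilinField (M : Type*) [TopologicalSpace M] [ChartedSpace H M] :=
  ∀ x : M, TangentSpace I x →L[ℝ] TangentSpace I x →L[ℝ] ℝ

/-- Smoothness of a `(0,2)`-tensor field, as a section of the bundle of bilinear forms. -/
def BilinField.Smooth [IsManifold I ∞ M] (b : BilinField I M) : Prop :=
  ContMDiff I (I.prod 𝓘(ℝ, E →L[ℝ] E →L[ℝ] ℝ)) ∞
    (fun x ↦ TotalSpace.mk' (E →L[ℝ] E →L[ℝ] ℝ)
      (E := fun x : M ↦ TangentSpace I x →L[ℝ] TangentSpace I x →L[ℝ] ℝ) x (b x))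

/-- The pull-back `φ^* b`, i.e. `(φ^* b)_p (u, v) = b_{φ p} (dφ_p u, dφ_p v)`. -/
def BilinField.pullback (b : BilinField I M) (φ : N → M) : BilinField I' N := fun p ↦
  (ContinuousLinearMap.precomp ℝ (mfderiv I' I φ p)).comp
    ((b (φ p)).comp (mfderiv I' I φ p))

@[simp]
lemma BilinField.pullback_apply (b : BilinField I M) (φ : N → M) (p : N)
    (u v : TangentSpace I' p) :
    b.pullback I I' φ p u v = b (φ p) (mfderiv I' I φ p u) (mfderiv I' I φ p v) := rfl

variable {I I'}

lemma BilinField.Smooth.pullback [IsManifold I ∞ M] [IsManifold I' ∞ N] {b : BilinField I M}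
    (hb : b.Smooth I) {φ : N → M} (hφ : ContMDiff I' I ∞ φ) :
    (b.pullback I I' φ).Smooth I' := by
  intro p₀
  refine (contMDiffAt_hom_bundle _).2 ⟨contMDiffAt_id, ?_⟩
  have hB := ((contMDiffAt_hom_bundle _).1 (hb (φ p₀))).2
  have hB' := hB.comp p₀ hφ.contMDiffAt
  have hA : ContMDiffAt I' 𝓘(ℝ, E' →L[ℝ] E) ∞
      (inTangentCoordinates I' I id φ (mfderiv I' I φ) p₀) p₀ :=
    ContMDiffAt.mfderiv_const (n := ∞) hφ.contMDiffAt (by simp)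
  have hC := (hA.clm_precomp (F₃ := ℝ)).clm_comp (hB'.clm_comp hA)
  refine hC.congr_of_eventuallyEq ?_
  have h1 : ∀ᶠ p in nhds p₀, p ∈ (chartAt H' p₀).source := chart_source_mem_nhds H' p₀
  have h2 : ∀ᶠ p in nhds p₀, φ p ∈ (chartAt H (φ p₀)).source :=
    hφ.continuous.continuousAt (chart_source_mem_nhds H (φ p₀))
  filter_upwards [h1, h2] with p hp hp'
  ext u v
  have hcancel : ∀ w : TangentSpace I (φ p),
      (trivializationAt E (TangentSpace I) (φ p₀)).symm (φ p)
        ((trivializationAt E (TangentSpace I) (φ p₀)).continuousLinearMapAt ℝ (φ p) w) = w :=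
    fun w ↦ by
      have hb' : φ p ∈ (trivializationAt E (TangentSpace I) (φ p₀)).baseSet := by
        simpa using hp'
      rw [← Bundle.Trivialization.symmL_apply (R := ℝ) _ hb']
      exact (trivializationAt E (TangentSpace I) (φ p₀)).symmL_continuousLinearMapAt
        (R := ℝ) hb' w
  have hbp : p ∈ (trivializationAt E' (TangentSpace I') p₀).baseSet := by simpa using hp
  change _ = (ContinuousLinearMap.inCoordinates E (TangentSpace I) (E →L[ℝ] ℝ)
    (fun b ↦ TangentSpace I b →L[ℝ] ℝ) (φ p₀) (φ p) (φ p₀) (φ p) (b (φ p)))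
      (inTangentCoordinates I' I id φ (mfderiv I' I φ) p₀ p u)
      (inTangentCoordinates I' I id φ (mfderiv I' I φ) p₀ p v)
  rw [inCoordinates_apply_eq₂ (by simpa using hp) (by simpa using hp) (mem_univ _),
    inCoordinates_apply_eq₂ (by simpa using hp') (by simpa using hp') (mem_univ _)]
  simp only [inTangentCoordinates, ContinuousLinearMap.inCoordinates,
    ContinuousLinearMap.comp_apply, hcancel]
  simp only [Trivial.fiberBundle_trivializationAt', Trivial.linearMapAt_trivialization,
    Bundle.Trivialization.symmL_apply _ hbp, BilinField.pullback_apply, id]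

end Pullback

/-! ### Semi-Riemannian metrics -/

section Metric

variable {E : Type*} [NormedAddCommGroup E] [NormedSpace ℝ E]
  {H : Type*} [TopologicalSpace H] (I : ModelWithCorners ℝ E H)
  (M : Type*) [TopologicalSpace M] [ChartedSpace H M] [IsManifold I ∞ M]

/-- A semi-Riemannian metric on `M`: a smooth symmetric nondegenerate `(0,2)`-tensor field.
Its index is locally constant, hence constant on connected manifolds. -/
structure SemiRiemannianMetric where
  /-- the scalar product `⟨u, v⟩` on each tangent space -/
  inner : BilinField I M
  symm : ∀ x u v, inner x u v = inner x v u
  nondegenerate : ∀ x u, (∀ v, inner x u v = 0) → u = 0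
  smooth : inner.Smooth I

variable {I M}

/-- A semi-Riemannian metric is Riemannian if it is positive definite. -/
def SemiRiemannianMetric.IsRiemannian (g : SemiRiemannianMetric I M) : Prop :=
  ∀ x, ∀ u : TangentSpace I x, u ≠ 0 → 0 < g.inner x u u

end Metric

/-! ### Warped products -/

section Warped

variable {E : Type*} [NormedAddCommGroup E] [NormedSpace ℝ E]
  {H : Type*} [TopologicalSpace H] {I : ModelWithCorners ℝ E H}
  {B : Type*} [TopologicalSpace B] [ChartedSpace H B] [IsManifold I ∞ B]
  {E' : Type*} [NormedAddCommGroup E'] [NormedSpace ℝ E']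
  {H' : Type*} [TopologicalSpace H'] {J : ModelWithCorners ℝ E' H'}
  {F : Type*} [TopologicalSpace F] [ChartedSpace H' F] [IsManifold J ∞ F]

/-- The warped product metric `π^* g_B + (f ∘ π)² σ^* g_F` on `B × F`. -/
def SemiRiemannianMetric.warpedProduct (gB : SemiRiemannianMetric I B)
    (gF : SemiRiemannianMetric J F) (f : B → ℝ) (hf : ContMDiff I 𝓘(ℝ, ℝ) ∞ f)
    (hpos : ∀ x, 0 < f x) : SemiRiemannianMetric (I.prod J) (B × F) where
  inner := fun p ↦ gB.inner.pullback I (I.prod J) (Prod.fst : B × F → B) p +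
    (f p.1) ^ 2 • gF.inner.pullback J (I.prod J) (Prod.snd : B × F → F) p
  symm x u v := by
    simp only [add_apply, smul_apply,
      BilinField.pullback_apply]
    rw [gB.symm, gF.symm]
  nondegenerate p u hu := by
    simp only [add_apply, smul_apply,
      BilinField.pullback_apply, mfderiv_fst, mfderiv_snd] at hu
    have h1 : u.1 = 0 := gB.nondegenerate p.1 _ fun v ↦ by
      have := hu (v, 0)
      change gB.inner p.1 u.1 v + f p.1 ^ 2 • gF.inner p.2 u.2 0 = 0 at this
      simpa using this
    have h2 : u.2 = 0 := gF.nondegenerate p.2 _ fun v ↦ by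
      have := hu (0, v)
      change gB.inner p.1 u.1 0 + f p.1 ^ 2 • gF.inner p.2 u.2 v = 0 at this
      simpa [(hpos p.1).ne'] using this
    exact Prod.ext h1 h2
  smooth := by
    have h1 := gB.smooth.pullback (I' := I.prod J) (φ := (Prod.fst : B × F → B)) contMDiff_fst
    have h2 := gF.smooth.pullback (I' := I.prod J) (φ := (Prod.snd : B × F → F)) contMDiff_snd
    have h3 : ContMDiff (I.prod J) 𝓘(ℝ, ℝ) ∞ (fun p : B × F ↦ (f p.1) ^ 2) :=
      (hf.comp contMDiff_fst).pow 2
    exact ContMDiff.add_section h1 (ContMDiff.smul_section h3 h2)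

end Warped

/-! ### Local expressions of connection and curvature -/

namespace LocalMetric

variable {E : Type*} [NormedAddCommGroup E] [NormedSpace ℝ E]

/-- The Christoffel symbols of the first kind of a metric `G` on an open set of `E`, as a
covector in the last argument: for constant vector fields `u, v, w`,
`⟨∇_u v, w⟩ = (∂_u (G(v,w)) + ∂_v (G(u,w)) - ∂_w (G(u,v))) / 2`. -/
def koszul (G : E → E →L[ℝ] E →L[ℝ] ℝ) (y u v : E) : E →L[ℝ] ℝ :=
  (1 / 2 : ℝ) • (fderiv ℝ (fun z ↦ G z v) y u + fderiv ℝ (fun z ↦ G z u) y v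
    - fderiv ℝ (fun z ↦ G z u v) y)

/-- The Christoffel symbols `Γ_y(u, v) = ∇_u v`, for constant vector fields `u, v`, obtained
from those of the first kind by inverting `G y : E → E^*`. -/
def christoffel (G : E → E →L[ℝ] E →L[ℝ] ℝ) (y u v : E) : E :=
  (G y).inverse (koszul G y u v)

/-- The curvature tensor `R(u, v) w = ∇_u ∇_v w - ∇_v ∇_u w`, for constant vector
fields `u, v, w`. -/
def curvature (G : E → E →L[ℝ] E →L[ℝ] ℝ) (y u v w : E) : E :=
  fderiv ℝ (fun z ↦ christoffel G z v w) y u - fderiv ℝ (fun z ↦ christoffel G z u w) y v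
    + christoffel G y u (christoffel G y v w) - christoffel G y v (christoffel G y u w)

/-- The covariant Hessian `Hess k (u, v) = ∂_u ∂_v k - (∇_u v) k`, for constant vector
fields `u, v`. -/
def hessian (G : E → E →L[ℝ] E →L[ℝ] ℝ) (k : E → ℝ) (y u v : E) : ℝ :=
  fderiv ℝ (fun z ↦ fderiv ℝ k z v) y u - fderiv ℝ k y (christoffel G y u v)

variable [FiniteDimensional ℝ E]

/-- The Ricci tensor `Ric(v, w) = tr (u ↦ R(u, v) w)`, the trace being computed in a basis. -/
def ricci (G : E → E →L[ℝ] E →L[ℝ] ℝ) (y v w : E) : ℝ :=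
  ∑ i, (Module.finBasis ℝ E).coord i (curvature G y (Module.finBasis ℝ E i) v w)

/-- The scalar curvature `∑ Ric_{ij} G^{ij}`, the trace of the Ricci tensor with respect
to `G`. Here `(G y)⁻¹ (e^i) = ∑_j G^{ij} e_j`, where `e^i` is the basis dual to `e_i`. -/
def scalarCurvature (G : E → E →L[ℝ] E →L[ℝ] ℝ) (y : E) : ℝ :=
  ∑ i, ricci G y (Module.finBasis ℝ E i)
    ((G y).inverse (LinearMap.toContinuousLinearMap ((Module.finBasis ℝ E).coord i)))

end LocalMetric

/-! ### Hessian, scalar curvature and gradient Yamabe solitons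

For the chart `φ = extChartAt I x` of a manifold without boundary, the tangent space
`TangentSpace I x` is, by definition, the model space `E`, a vector being identified with
its coordinates in `φ`. The Hessian and the scalar curvature are tensorial, so that their values
at `x` may be computed in this chart. -/

namespace SemiRiemannianMetric

variable {E : Type*} [NormedAddCommGroup E] [NormedSpace ℝ E]
  {H : Type*} [TopologicalSpace H] {I : ModelWithCorners ℝ E H} [I.Boundaryless]
  {M : Type*} [TopologicalSpace M] [ChartedSpace H M] [IsManifold I ∞ M]

/-- The expression of `g` in the chart at `x`, i.e. its pull-back by the inverse chart. -/
def inChart (g : SemiRiemannianMetric I M) (x : M) : E → E →L[ℝ] E →L[ℝ] ℝ :=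
  g.inner.pullback I 𝓘(ℝ, E) (extChartAt I x).symm

/-- The Hessian `Hess_g(h)` of a function `h` at the point `x`. -/
def hessian (g : SemiRiemannianMetric I M) (h : M → ℝ) (x : M) (u v : TangentSpace I x) : ℝ :=
  LocalMetric.hessian (g.inChart x) (h ∘ (extChartAt I x).symm) (extChartAt I x x) u v

/-- The scalar curvature `S_g` at the point `x`. -/
def scalarCurvature [FiniteDimensional ℝ E] (g : SemiRiemannianMetric I M) (x : M) : ℝ :=
  LocalMetric.scalarCurvature (g.inChart x) (extChartAt I x x)

/-- `(M, g, ∇h)` is a gradient Yamabe soliton with potential function `h` and soliton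
constant `ρ`: `h` is smooth and `(S_g - ρ) g = Hess_g(h)`. -/
def IsGradientYamabeSoliton [FiniteDimensional ℝ E] (g : SemiRiemannianMetric I M)
    (h : M → ℝ) (ρ : ℝ) : Prop :=
  ContMDiff I 𝓘(ℝ, ℝ) ∞ h ∧ ∀ x, ∀ u v : TangentSpace I x,
    (g.scalarCurvature x - ρ) * g.inner x u v = g.hessian h x u v

end SemiRiemannianMetric

end

/-! Write the soliton equation as `Hess h̃ = ψ ḡ` with `ψ = S - ρ`, where `h̃` is the lift of `h`.
The gradient of `h̃` is the horizontal lift of `∇h`. On vertical vectors the Hessian of `h̃` is `f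
⟨∇f, ∇h⟩ g_F`. Comparison with `ψ f² g_F` gives `ψ = ⟨∇f, ∇h⟩ / f` (`warped_factor`). For any
function, `d|∇h|² = 2 Hess h (∇h, ·)`, so here `d|∇h|² = 2 ψ dh` (`hasFDerivAt_normSq_gradient`).
Together these yield `f d|∇h|² = 2 ⟨∇f, ∇h⟩ dh` on the base
(`hasFDerivAt_gradientProduct_of_hessian_eq`).

Put `q = |∇h|²`. Two applications of Cauchy–Schwarz (`norm_smul_gradient_le`) bound `|dq|` by a
continuous multiple of `q`, so by Grönwall (`eventually_eq_zero_of_norm_fderiv_le`) `q` vanishes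
near each of its zeros. The zero set of `q` is therefore open and closed; by compactness it contains
a maximum point of `h`. As the base is connected, `q` vanishes identically and `h` is constant
(`IsRiemannian.exists_eq_const`). -/

/-! ### Hessian and gradient in coordinates. -/

namespace LocalMetric

variable {E : Type*} [NormedAddCommGroup E] [NormedSpace ℝ E]

lemma apply_koszul {G : E → E →L[ℝ] E →L[ℝ] ℝ} {y : E} (hG : DifferentiableAt ℝ G y)
    (u v w : E) :
    koszul G y u v w = (1 / 2 : ℝ) *
      (fderiv ℝ G y u v w + fderiv ℝ G y v u w - fderiv ℝ G y w u v) := by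
  have h1 (v : E) : HasFDerivAt (fun z ↦ G z v) ((fderiv ℝ G y).flip v) y := by
    simpa using hG.hasFDerivAt.clm_apply (hasFDerivAt_const v y)
  have h2 : HasFDerivAt (fun z ↦ G z u v) (((fderiv ℝ G y).flip u).flip v) y := by
    simpa using (h1 u).clm_apply (hasFDerivAt_const v y)
  simp [koszul, (h1 _).fderiv, h2.fderiv]

/-- The Hessian of `k` in terms of the gradient `X` of `k`. -/
lemma hessian_eq {G : E → E →L[ℝ] E →L[ℝ] ℝ} {y : E} (hG : DifferentiableAt ℝ G y)
    (hsymm : ∀ u v, G y u v = G y v u) (hinv : (G y).IsInvertible) {k : E → ℝ}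
    (hk : DifferentiableAt ℝ (fderiv ℝ k) y) {X : E} (hX : G y X = fderiv ℝ k y) (u v : E) :
    hessian G k y u v = fderiv ℝ (fderiv ℝ k) y u v - (1 / 2 : ℝ) *
      (fderiv ℝ G y u v X + fderiv ℝ G y v u X - fderiv ℝ G y X u v) := by
  have h1 : HasFDerivAt (fun z ↦ fderiv ℝ k z v) ((fderiv ℝ (fderiv ℝ k) y).flip v) y := by
    simpa using hk.hasFDerivAt.clm_apply (hasFDerivAt_const v y)
  -- Pairing with the gradient lowers the index, so the inverse of `G` disappears.
  have h2 : fderiv ℝ k y (christoffel G y u v) = koszul G y u v X := by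
    rw [← hX, hsymm, christoffel]
    obtain ⟨e, he⟩ := hinv
    rw [← he, ContinuousLinearMap.inverse_equiv]
    simp
  rw [hessian, h1.fderiv, h2, apply_koszul hG]
  simp

/-- If `Hess k = ψ G` at `y`, then `d|∇k|² = 2 ψ dk` at `y`. -/
lemma hasFDerivAt_normSq_gradient {G : E → E →L[ℝ] E →L[ℝ] ℝ} {y : E}
    (hG : DifferentiableAt ℝ G y) (hsymm : ∀ u v, G y u v = G y v u)
    (hinv : (G y).IsInvertible) {k : E → ℝ} (hk : DifferentiableAt ℝ (fderiv ℝ k) y)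
    {X : E → E} (hXd : DifferentiableAt ℝ X y) (hX : ∀ᶠ z in nhds y, G z (X z) = fderiv ℝ k z)
    {ψ : ℝ} (hess : ∀ u v, ψ * G y u v = hessian G k y u v) :
    HasFDerivAt (fun z ↦ fderiv ℝ k z (X z)) ((2 * ψ) • fderiv ℝ k y) y := by
  have hXy := hX.self_of_nhds
  have h1 := hk.hasFDerivAt.clm_apply hXd.hasFDerivAt
  have h2 := (hG.hasFDerivAt.clm_apply hXd.hasFDerivAt).congr_of_eventuallyEq
    (hX.mono fun z hz ↦ hz.symm)
  -- Differentiating `G X = dk` expresses `G (dX u)` through second derivatives of `k` and first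
  -- derivatives of `G`.
  have h3 := h2.unique hk.hasFDerivAt
  refine h1.congr_fderiv (ContinuousLinearMap.ext fun u ↦ ?_)
  -- With `v = X` two of the three Koszul terms cancel: `ψ dk(u) = d²k(u, X) - dG(u)(X, X) / 2`.
  -- Evaluating `h3` at the same pair gives `dk(dX u) = d²k(u, X) - dG(u)(X, X)`.
  have h4 := congr($h3 u (X y))
  have h5 := hess u (X y)
  rw [hessian_eq hG hsymm hinv hk hXy, hsymm, hXy] at h5
  simp only [add_apply, ContinuousLinearMap.comp_apply,
    ContinuousLinearMap.flip_apply, smul_apply, smul_eq_mul] at h4 ⊢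
  rw [hsymm, hXy] at h4
  linarith

/-- Nondegeneracy is injectivity into the dual, which has the same dimension. -/
lemma isInvertible_of_nondegenerate [FiniteDimensional ℝ E] {b : E →L[ℝ] E →L[ℝ] ℝ}
    (hb : ∀ u, (∀ v, b u v = 0) → u = 0) : b.IsInvertible := by
  have hinj : Function.Injective b :=
    (injective_iff_map_eq_zero b).2 fun u hu ↦ hb u fun v ↦ congr($hu v)
  have hdim : Module.finrank ℝ E = Module.finrank ℝ (E →L[ℝ] ℝ) := by
    rw [← (LinearMap.toContinuousLinearMap (𝕜 := ℝ) (E := E) (F' := ℝ)).finrank_eq]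
    exact (Subspace.dual_finrank_eq (K := ℝ) (V := E)).symm
  refine ⟨(LinearEquiv.ofInjectiveOfFinrankEq
    b.toLinearMap hinj hdim).toContinuousLinearEquiv, ?_⟩
  ext u v
  rfl

/-! ### Warped products in coordinates. -/

section Product

variable {E' : Type*} [NormedAddCommGroup E'] [NormedSpace ℝ E']

/-- For a function on the base of a warped product with warping function `√r`, the factor `ψ` in
`Hess k = ψ G` is determined by the directions tangent to the fibre. -/
lemma warped_factor {G : E × E' → E × E' →L[ℝ] E × E' →L[ℝ] ℝ}
    {GB : E → E →L[ℝ] E →L[ℝ] ℝ} {GF : E' → E' →L[ℝ] E' →L[ℝ] ℝ} {r : E → ℝ} {y : E × E'}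
    (hG : DifferentiableAt ℝ G y) (hinv : (G y).IsInvertible)
    (hsymm : ∀ u v, G y u v = G y v u)
    (hGe : ∀ᶠ z in nhds y, ∀ u v, G z u v = GB z.1 u.1 v.1 + r z.1 * GF z.2 u.2 v.2)
    (hr : DifferentiableAt ℝ r y.1) {k : E → ℝ} (hkd : ∀ᶠ z in nhds y.1, DifferentiableAt ℝ k z)
    (hk : DifferentiableAt ℝ (fderiv ℝ k) y.1) {X : E} (hX : GB y.1 X = fderiv ℝ k y.1)
    {ψ : ℝ} (hess : ∀ u v, ψ * G y u v = hessian G (fun z ↦ k z.1) y u v)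
    {a b : E'} (hab : GF y.2 a b ≠ 0) :
    ψ * r y.1 = (1 / 2 : ℝ) * fderiv ℝ r y.1 X := by
  have hGy := hGe.self_of_nhds
  have hk1 : fderiv ℝ (fun z : E × E' ↦ k z.1) =ᶠ[nhds y]
      fun z ↦ (fderiv ℝ k z.1).comp (ContinuousLinearMap.fst ℝ E E') := by
    filter_upwards [continuousAt_fst.eventually hkd] with z hz
    exact (hz.hasFDerivAt.comp z hasFDerivAt_fst).fderiv
  have hk2 : HasFDerivAt (fderiv ℝ (fun z : E × E' ↦ k z.1)) _ y :=
    (((hk.hasFDerivAt.comp y hasFDerivAt_fst).clm_comp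
      (hasFDerivAt_const (ContinuousLinearMap.fst ℝ E E') y)).congr_of_eventuallyEq hk1)
  have hX' : G y (X, 0) = fderiv ℝ (fun z : E × E' ↦ k z.1) y := by
    rw [hk1.self_of_nhds]
    ext <;> simp [hGy, ← hX]
  have hd (u v : E × E') : HasFDerivAt (fun z ↦ G z u v)
      (((fderiv ℝ G y).flip u).flip v) y := by
    have h1 : HasFDerivAt (fun z ↦ G z u) ((fderiv ℝ G y).flip u) y := by
      simpa using hG.hasFDerivAt.clm_apply (hasFDerivAt_const u y)
    simpa using h1.clm_apply (hasFDerivAt_const v y)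
  -- Base and fibre are orthogonal at every point near `y`, so this component of `G` is locally
  -- zero.
  have hmix (c : E') (w : E × E') : fderiv ℝ G y w (0, c) (X, 0) = 0 := by
    have h0 : HasFDerivAt (fun z ↦ G z (0, c) (X, 0)) (0 : E × E' →L[ℝ] ℝ) y :=
      (hasFDerivAt_const (0 : ℝ) y).congr_of_eventuallyEq (hGe.mono fun z hz ↦ by simp [hz])
    simpa using congr($((hd (0, c) (X, 0)).unique h0) w)
  -- Along a line in the base the fibre metric is frozen; only `r` varies, and differentiability of
  -- `GF` is not needed.
  have hvert : fderiv ℝ G y (X, 0) (0, a) (0, b) = fderiv ℝ r y.1 X * GF y.2 a b := by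
    have hl : HasDerivAt (fun t : ℝ ↦ y.1 + t • X) X 0 := by
      simpa using ((hasDerivAt_id (0 : ℝ)).smul_const X).const_add y.1
    have hl' : HasDerivAt (fun t : ℝ ↦ (y.1 + t • X, y.2)) (X, 0) 0 :=
      hl.prodMk (hasDerivAt_const (0 : ℝ) y.2)
    have h0 : HasDerivAt (fun t : ℝ ↦ G (y.1 + t • X, y.2) (0, a) (0, b))
        (fderiv ℝ G y (X, 0) (0, a) (0, b)) 0 := by
      have hd0 : HasFDerivAt (fun z ↦ G z (0, a) (0, b))
          (((fderiv ℝ G y).flip (0, a)).flip (0, b)) (y.1 + (0 : ℝ) • X, y.2) := by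
        simpa using hd (0, a) (0, b)
      exact hd0.comp_hasDerivAt (0 : ℝ) hl'
    have h1 : HasDerivAt (fun t : ℝ ↦ r (y.1 + t • X) * GF y.2 a b)
        (fderiv ℝ r y.1 X * GF y.2 a b) 0 :=
      ((show HasFDerivAt r (fderiv ℝ r y.1) (y.1 + (0 : ℝ) • X) by
        simpa using hr.hasFDerivAt).comp_hasDerivAt (0 : ℝ) hl).mul_const _
    refine h0.unique (h1.congr_of_eventuallyEq ?_)
    have hc : Filter.Tendsto (fun t : ℝ ↦ (y.1 + t • X, y.2)) (nhds 0) (nhds y) := by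
      simpa [ContinuousAt] using hl'.continuousAt
    filter_upwards [hc.eventually hGe] with t ht
    simp [ht]
  have hsec : fderiv ℝ (fderiv ℝ (fun z : E × E' ↦ k z.1)) y (0, a) (0, b) = 0 := by
    have h1 : HasFDerivAt (fun z ↦ fderiv ℝ (fun z : E × E' ↦ k z.1) z (0, b))
        ((fderiv ℝ (fderiv ℝ (fun z : E × E' ↦ k z.1)) y).flip (0, b)) y := by
      simpa using hk2.differentiableAt.hasFDerivAt.clm_apply (hasFDerivAt_const (0, b) y)
    have h0 := (hasFDerivAt_const (𝕜 := ℝ) (0 : ℝ) y).congr_of_eventuallyEq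
      (hk1.mono fun z hz ↦ show fderiv ℝ (fun z : E × E' ↦ k z.1) z (0, b) = 0 by simp [hz])
    simpa using congr($(h1.unique h0) (0, a))
  have h5 := hess (0, a) (0, b)
  rw [hessian_eq hG hsymm hinv hk2.differentiableAt hX', hmix, hmix, hvert, hsec, hGy] at h5
  simp only [map_zero, zero_add, zero_sub] at h5
  apply mul_right_cancel₀ hab
  linarith

/-- If `Hess k = ψ G` for a function `k` on the base of a warped product with metric `G`, then
`d|∇k|² = 2 ψ dk` on the base. -/
lemma hasFDerivAt_normSq_gradient_of_warped {G : E × E' → E × E' →L[ℝ] E × E' →L[ℝ] ℝ}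
    {GB : E → E →L[ℝ] E →L[ℝ] ℝ} {GF : E' → E' →L[ℝ] E' →L[ℝ] ℝ} {r : E → ℝ} {y : E × E'}
    (hG : DifferentiableAt ℝ G y) (hinv : (G y).IsInvertible)
    (hsymm : ∀ u v, G y u v = G y v u)
    (hGe : ∀ᶠ z in nhds y, ∀ u v, G z u v = GB z.1 u.1 v.1 + r z.1 * GF z.2 u.2 v.2)
    {k : E → ℝ} (hkd : ∀ᶠ z in nhds y.1, DifferentiableAt ℝ k z)
    (hk : DifferentiableAt ℝ (fderiv ℝ k) y.1) {X : E → E} (hXd : DifferentiableAt ℝ X y.1)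
    (hX : ∀ᶠ z in nhds y.1, GB z (X z) = fderiv ℝ k z)
    {ψ : ℝ} (hess : ∀ u v, ψ * G y u v = hessian G (fun z ↦ k z.1) y u v) :
    HasFDerivAt (fun z ↦ fderiv ℝ k z (X z)) ((2 * ψ) • fderiv ℝ k y.1) y.1 := by
  have hK (z : E × E') (hz : DifferentiableAt ℝ k z.1) :
      fderiv ℝ (fun z : E × E' ↦ k z.1) z =
        (fderiv ℝ k z.1).comp (ContinuousLinearMap.fst ℝ E E') :=
    (hz.hasFDerivAt.comp z hasFDerivAt_fst).fderiv
  have hkd' := (continuousAt_fst (p := y)).eventually hkd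
  have hKd : DifferentiableAt ℝ (fderiv ℝ (fun z : E × E' ↦ k z.1)) y := by
    have h1 : DifferentiableAt ℝ (fun z : E × E' ↦ fderiv ℝ k z.1) y :=
      hk.comp y differentiableAt_fst
    exact (h1.clm_comp (differentiableAt_const _)).congr_of_eventuallyEq (hkd'.mono hK)
  have hXd' : DifferentiableAt ℝ (fun z : E × E' ↦ (X z.1, (0 : E'))) y := by
    have h1 : DifferentiableAt ℝ (fun z : E × E' ↦ X z.1) y := hXd.comp y differentiableAt_fst
    exact h1.prodMk (differentiableAt_const _)
  have hXK : ∀ᶠ z in nhds y, G z (X z.1, 0) = fderiv ℝ (fun z : E × E' ↦ k z.1) z := by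
    filter_upwards [hGe, hkd', (continuousAt_fst (p := y)).eventually hX] with z hz1 hz2 hz3
    refine ContinuousLinearMap.ext fun u ↦ ?_
    rw [hz1, hK z hz2, hz3, map_zero, zero_apply, mul_zero, add_zero]
    rfl
  have h3 : HasFDerivAt (fun z ↦ fderiv ℝ (fun z : E × E' ↦ k z.1) z (X z.1, 0))
      ((2 * ψ) • fderiv ℝ (fun z : E × E' ↦ k z.1) y) (y.1, y.2) :=
    hasFDerivAt_normSq_gradient hG hsymm hinv hKd hXd' hXK hess
  -- Restriction to the horizontal slice through `y` turns the identity on the product into one on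
  -- the base.
  have h4 := h3.comp y.1 (hasFDerivAt_prodMk_left (𝕜 := ℝ) y.1 y.2)
  refine (h4.congr_of_eventuallyEq (hkd.mono fun z hz ↦ ?_)).congr_fderiv ?_
  · change _ = fderiv ℝ (fun z : E × E' ↦ k z.1) (z, y.2) (X z, 0)
    rw [hK _ hz]
    rfl
  · rw [hK _ hkd.self_of_nhds]
    ext u
    rfl

end Product

end LocalMetric

/-! ### Metric, gradient and differentials in charts. -/

section Charts

variable {E : Type*} [NormedAddCommGroup E] [NormedSpace ℝ E]
  {H : Type*} [TopologicalSpace H] {I : ModelWithCorners ℝ E H}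
  {M : Type*} [TopologicalSpace M] [ChartedSpace H M] [IsManifold I ∞ M]

namespace SemiRiemannianMetric

variable (g : SemiRiemannianMetric I M)

lemma inChart_apply (x : M) (z u v : E) :
    g.inChart x z u v = g.inner ((extChartAt I x).symm z)
      (mfderiv 𝓘(ℝ, E) I (extChartAt I x).symm z u)
      (mfderiv 𝓘(ℝ, E) I (extChartAt I x).symm z v) := rfl

lemma inChart_symm (x : M) (z u v : E) : g.inChart x z u v = g.inChart x z v u := by
  simp only [inChart_apply]
  exact g.symm _ _ _

/-- The scalar product at `x`, as a bilinear form on the model space. -/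
def innerModel (x : M) : E →L[ℝ] E →L[ℝ] ℝ := g.inner x

lemma isInvertible_innerModel [FiniteDimensional ℝ E] (x : M) : (g.innerModel x).IsInvertible :=
  LocalMetric.isInvertible_of_nondegenerate (E := E) (g.nondegenerate x)

/-- The gradient of a function, characterised by `⟨∇k, v⟩ = dk(v)`. -/
noncomputable def gradient (k : M → ℝ) (x : M) : TangentSpace I x :=
  (g.innerModel x).inverse (mfderiv I 𝓘(ℝ, ℝ) k x)

lemma inner_gradient [FiniteDimensional ℝ E] (k : M → ℝ) (x : M) (v : TangentSpace I x) :
    g.inner x (g.gradient k x) v = mfderiv I 𝓘(ℝ, ℝ) k x v :=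
  congr($((g.isInvertible_innerModel x).self_apply_inverse (mfderiv I 𝓘(ℝ, ℝ) k x)) v)

/-- The gradient of `k` in the chart at `x`. -/
noncomputable def gradientInChart (k : M → ℝ) (x : M) (z : E) : E :=
  (g.inChart x z).inverse (fderiv ℝ (k ∘ (extChartAt I x).symm) z)

/-- The scalar product `⟨∇k, ∇l⟩ = dk(∇l)`. -/
noncomputable def gradientProduct (k l : M → ℝ) (x : M) : ℝ :=
  mfderiv I 𝓘(ℝ, ℝ) k x (g.gradient l x)

end SemiRiemannianMetric

/-- The components of a smooth bilinear form in a chart are smooth. -/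
lemma BilinField.Smooth.contDiffAt_pullback {b : BilinField I M} (hb : b.Smooth I) {φ : E → M}
    {z₀ : E} (hφ : ContMDiffAt 𝓘(ℝ, E) I ∞ φ z₀) :
    ContDiffAt ℝ ∞ (F := E →L[ℝ] E →L[ℝ] ℝ)
      (fun z : E ↦ b.pullback I 𝓘(ℝ, E) φ z) z₀ := by
  refine ContMDiffAt.contDiffAt (?_ : ContMDiffAt 𝓘(ℝ, E) 𝓘(ℝ, E →L[ℝ] E →L[ℝ] ℝ) ∞
    (M' := E →L[ℝ] E →L[ℝ] ℝ) (fun z : E ↦ b.pullback I 𝓘(ℝ, E) φ z) z₀)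
  have hB := ((contMDiffAt_hom_bundle _).1 (hb (φ z₀))).2
  have hB' := hB.comp z₀ hφ
  have hA : ContMDiffAt 𝓘(ℝ, E) 𝓘(ℝ, E →L[ℝ] E) ∞
      (inTangentCoordinates 𝓘(ℝ, E) I id φ (mfderiv 𝓘(ℝ, E) I φ) z₀) z₀ :=
    ContMDiffAt.mfderiv_const (n := ∞) hφ (by simp)
  have hC := (hA.clm_precomp (F₃ := ℝ)).clm_comp (hB'.clm_comp hA)
  refine hC.congr_of_eventuallyEq ?_
  filter_upwards [hφ.continuousAt (chart_source_mem_nhds H (φ z₀))] with p hp'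
  ext u v
  have hcancel : ∀ w : TangentSpace I (φ p),
      (trivializationAt E (TangentSpace I) (φ z₀)).symm (φ p)
        ((trivializationAt E (TangentSpace I) (φ z₀)).continuousLinearMapAt ℝ (φ p) w) = w :=
    fun w ↦ by
      have hb' : φ p ∈ (trivializationAt E (TangentSpace I) (φ z₀)).baseSet := by
        simpa using hp'
      rw [← Bundle.Trivialization.symmL_apply (R := ℝ) _ hb']
      exact (trivializationAt E (TangentSpace I) (φ z₀)).symmL_continuousLinearMapAt
        (R := ℝ) hb' w
  change _ = (ContinuousLinearMap.inCoordinates E (TangentSpace I) (E →L[ℝ] ℝ)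
    (fun b ↦ TangentSpace I b →L[ℝ] ℝ) (φ z₀) (φ p) (φ z₀) (φ p) (b (φ p)))
      (inTangentCoordinates 𝓘(ℝ, E) I id φ (mfderiv 𝓘(ℝ, E) I φ) z₀ p u)
      (inTangentCoordinates 𝓘(ℝ, E) I id φ (mfderiv 𝓘(ℝ, E) I φ) z₀ p v)
  rw [inCoordinates_apply_eq₂ (by simpa using hp') (by simpa using hp') (mem_univ _)]
  have hid (w : TangentSpace 𝓘(ℝ, E) p) :
      inTangentCoordinates 𝓘(ℝ, E) I id φ (mfderiv 𝓘(ℝ, E) I φ) z₀ p w =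
        (trivializationAt E (TangentSpace I) (φ z₀)).continuousLinearMapAt ℝ (φ p)
          (mfderiv 𝓘(ℝ, E) I φ p w) := by
    simp [inTangentCoordinates, ContinuousLinearMap.inCoordinates]
    rfl
  rw [hid, hid, hcancel, hcancel]
  simp

variable [I.Boundaryless]

variable (I) in
lemma contMDiffAt_extChartAt_symm {x : M} {z : E} (hz : z ∈ (extChartAt I x).target) :
    ContMDiffAt 𝓘(ℝ, E) I ∞ (extChartAt I x).symm z :=
  (contMDiffOn_extChartAt_symm x).contMDiffAt ((isOpen_extChartAt_target x).mem_nhds hz)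

variable (I) in
lemma isInvertible_mfderiv_extChartAt_symm {x : M} {z : E} (hz : z ∈ (extChartAt I x).target) :
    (mfderiv 𝓘(ℝ, E) I (extChartAt I x).symm z).IsInvertible := by
  have : IsManifold I 1 M := IsManifold.of_le (n := ∞) (by simp)
  have := isInvertible_mfderivWithin_extChartAt_symm hz
  rwa [I.range_eq_univ, mfderivWithin_univ] at this

variable (I) in
lemma mfderiv_extChartAt_symm_self (x : M) :
    mfderiv 𝓘(ℝ, E) I (extChartAt I x).symm (extChartAt I x x) = ContinuousLinearMap.id ℝ E := by
  have h1 := (contMDiffAt_extChartAt_symm I (mem_extChartAt_target (I := I) x)).mdifferentiableAt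
    (by simp)
  -- The manifold derivative uses the chart centred at the image point, which equals `x` only
  -- propositionally; a free `y` allows substitution.
  have h2 (y : M) (hy : y = x) : fderivWithin ℝ (extChartAt I y ∘ (extChartAt I x).symm)
      (range 𝓘(ℝ, E)) (extChartAt I x x) = ContinuousLinearMap.id ℝ E := by
    subst hy
    have := fderivWithin_extChartAt_comp_extChartAt_symm_range (I := I) (x := y)
    rwa [I.range_eq_univ, ← 𝓘(ℝ, E).range_eq_univ] at this
  exact h1.mfderiv.trans (h2 _ (extChartAt_to_inv x))

lemma fderiv_comp_extChartAt_symm {k : M → ℝ} {x : M} {z : E} (hz : z ∈ (extChartAt I x).target)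
    (hk : MDifferentiableAt I 𝓘(ℝ, ℝ) k ((extChartAt I x).symm z)) (u : E) :
    fderiv ℝ (k ∘ (extChartAt I x).symm) z u =
      mfderiv I 𝓘(ℝ, ℝ) k ((extChartAt I x).symm z)
        (mfderiv 𝓘(ℝ, E) I (extChartAt I x).symm z u) := by
  rw [← mfderiv_eq_fderiv, mfderiv_comp z hk
    ((contMDiffAt_extChartAt_symm I hz).mdifferentiableAt (by simp))]
  rfl

lemma contDiffAt_comp_extChartAt_symm {k : M → ℝ} (hk : ContMDiff I 𝓘(ℝ, ℝ) ∞ k) {x : M} {z : E}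
    (hz : z ∈ (extChartAt I x).target) : ContDiffAt ℝ ∞ (k ∘ (extChartAt I x).symm) z :=
  (hk.contMDiffAt.comp z (contMDiffAt_extChartAt_symm I hz)).contDiffAt

namespace SemiRiemannianMetric

variable (g : SemiRiemannianMetric I M)

lemma contDiffAt_inChart {x : M} {z : E} (hz : z ∈ (extChartAt I x).target) :
    ContDiffAt ℝ ∞ (g.inChart x) z :=
  g.smooth.contDiffAt_pullback (contMDiffAt_extChartAt_symm I hz)

lemma isInvertible_inChart [FiniteDimensional ℝ E] {x : M} {z : E}
    (hz : z ∈ (extChartAt I x).target) : (g.inChart x z).IsInvertible := by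
  refine LocalMetric.isInvertible_of_nondegenerate fun u hu ↦ ?_
  obtain ⟨A, hA⟩ := isInvertible_mfderiv_extChartAt_symm I hz
  simp only [inChart_apply, ← hA] at hu
  exact A.map_eq_zero_iff.1 (g.nondegenerate _ _ fun v ↦ by
    obtain ⟨w, rfl⟩ := A.surjective v
    exact hu w)

/-- The expression in a chart of the gradient of `k`. -/
lemma mfderiv_extChartAt_symm_gradient [FiniteDimensional ℝ E] {k : M → ℝ} {x : M} {z : E}
    (hz : z ∈ (extChartAt I x).target)
    (hk : MDifferentiableAt I 𝓘(ℝ, ℝ) k ((extChartAt I x).symm z)) :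
    mfderiv 𝓘(ℝ, E) I (extChartAt I x).symm z (g.gradientInChart k x z) =
      g.gradient k ((extChartAt I x).symm z) := by
  rw [← sub_eq_zero]
  refine g.nondegenerate _ _ fun v ↦ ?_
  obtain ⟨A, hA⟩ := isInvertible_mfderiv_extChartAt_symm I hz
  obtain ⟨w, rfl⟩ : ∃ w : E, mfderiv 𝓘(ℝ, E) I (extChartAt I x).symm z w = v :=
    ⟨A.symm v, by rw [← hA]; exact A.apply_symm_apply v⟩
  rw [map_sub, sub_apply, inner_gradient, ← inChart_apply, gradientInChart,
    (g.isInvertible_inChart hz).self_apply_inverse, fderiv_comp_extChartAt_symm hz hk]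
  exact sub_self _

lemma inChart_gradientInChart [FiniteDimensional ℝ E] (k : M → ℝ) {x : M} {z : E}
    (hz : z ∈ (extChartAt I x).target) :
    g.inChart x z (g.gradientInChart k x z) = fderiv ℝ (k ∘ (extChartAt I x).symm) z :=
  (g.isInvertible_inChart hz).self_apply_inverse _

/-- Inversion of operators is smooth at an invertible one, and both the metric and `dk` are smooth
in the chart. -/
lemma contDiffAt_gradientInChart [FiniteDimensional ℝ E] {k : M → ℝ}
    (hk : ContMDiff I 𝓘(ℝ, ℝ) ∞ k) {x : M} {z : E} (hz : z ∈ (extChartAt I x).target) :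
    ContDiffAt ℝ ∞ (g.gradientInChart k x) z := by
  have := FiniteDimensional.complete ℝ E
  exact ((g.isInvertible_inChart hz).contDiffAt_map_inverse.comp z
    (g.contDiffAt_inChart hz)).clm_apply
      ((contDiffAt_comp_extChartAt_symm hk hz).fderiv_right (by simp))

/-- The scalar product of two gradients, computed in a chart. -/
lemma gradientProduct_extChartAt_symm [FiniteDimensional ℝ E] {k l : M → ℝ}
    (hk : MDifferentiable I 𝓘(ℝ, ℝ) k) (hl : MDifferentiable I 𝓘(ℝ, ℝ) l) {x : M} {z : E}
    (hz : z ∈ (extChartAt I x).target) :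
    g.gradientProduct k l ((extChartAt I x).symm z) =
      fderiv ℝ (k ∘ (extChartAt I x).symm) z (g.gradientInChart l x z) := by
  rw [fderiv_comp_extChartAt_symm hz (hk _), g.mfderiv_extChartAt_symm_gradient hz (hl _)]
  rfl

lemma contDiffAt_gradientProduct [FiniteDimensional ℝ E] {k l : M → ℝ}
    (hk : ContMDiff I 𝓘(ℝ, ℝ) ∞ k) (hl : ContMDiff I 𝓘(ℝ, ℝ) ∞ l) {x : M} {z : E}
    (hz : z ∈ (extChartAt I x).target) :
    ContDiffAt ℝ ∞ (g.gradientProduct k l ∘ (extChartAt I x).symm) z := by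
  refine (((contDiffAt_comp_extChartAt_symm hk hz).fderiv_right (m := ∞) (by simp)).clm_apply
    (g.contDiffAt_gradientInChart hl hz)).congr_of_eventuallyEq ?_
  filter_upwards [(isOpen_extChartAt_target x).mem_nhds hz] with w hw
  exact g.gradientProduct_extChartAt_symm (hk.mdifferentiable (by simp))
    (hl.mdifferentiable (by simp)) hw

end SemiRiemannianMetric

end Charts

/-! ### Grönwall and Cauchy–Schwarz estimates. -/

section Local

variable {E : Type*} [NormedAddCommGroup E] [NormedSpace ℝ E]

/-- A function which satisfies `‖dq‖ ≤ C |q|` near one of its zeros vanishes near this zero. -/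
lemma eventually_eq_zero_of_norm_fderiv_le {q C : E → ℝ} {z₀ : E} (hC : ContinuousAt C z₀)
    (hq : ∀ᶠ z in nhds z₀, DifferentiableAt ℝ q z)
    (hqC : ∀ᶠ z in nhds z₀, ‖fderiv ℝ q z‖ ≤ C z * ‖q z‖) (h0 : q z₀ = 0) :
    ∀ᶠ z in nhds z₀, q z = 0 := by
  obtain ⟨r, hr, hball⟩ := Metric.eventually_nhds_iff_ball.1
    (hq.and (hqC.and (hC.eventually (gt_mem_nhds (lt_add_one (C z₀))))))
  filter_upwards [Metric.ball_mem_nhds z₀ hr] with z hz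
  have hmem (t : ℝ) (ht : t ∈ Icc (0 : ℝ) 1) : z₀ + t • (z - z₀) ∈ Metric.ball z₀ r := by
    rw [mem_ball_iff_norm, add_sub_cancel_left, norm_smul, Real.norm_of_nonneg ht.1]
    exact (mul_le_of_le_one_left (norm_nonneg _) ht.2).trans_lt (mem_ball_iff_norm.1 hz)
  have hd (t : ℝ) (ht : t ∈ Icc (0 : ℝ) 1) : HasDerivAt (fun t : ℝ ↦ q (z₀ + t • (z - z₀)))
      (fderiv ℝ q (z₀ + t • (z - z₀)) (z - z₀)) t := by
    have hl : HasDerivAt (fun t : ℝ ↦ z₀ + t • (z - z₀)) (z - z₀) t := by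
      simpa using ((hasDerivAt_id t).smul_const (z - z₀)).const_add z₀
    exact (hball _ (hmem t ht)).1.hasFDerivAt.comp_hasDerivAt t hl
  -- Grönwall along the segment from `z₀` to `z`: on the ball `C < C z₀ + 1`, and the velocity
  -- contributes `‖z - z₀‖`. Zero initial value and zero error term force zero.
  have key := norm_le_gronwallBound_of_norm_deriv_right_le (δ := 0) (ε := 0)
    (K := (C z₀ + 1) * ‖z - z₀‖) (a := 0) (b := 1)
    (fun t ht ↦ (hd t ht).continuousAt.continuousWithinAt)
    (fun t ht ↦ (hd t ⟨ht.1, ht.2.le⟩).hasDerivWithinAt) (by simp [h0])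
    (fun t ht ↦ by
      obtain ⟨-, h1, h2⟩ := hball _ (hmem t ⟨ht.1, ht.2.le⟩)
      calc _ ≤ ‖fderiv ℝ q (z₀ + t • (z - z₀))‖ * ‖z - z₀‖ := ContinuousLinearMap.le_opNorm _ _
        _ ≤ (C z₀ + 1) * ‖q (z₀ + t • (z - z₀))‖ * ‖z - z₀‖ := by
          gcongr
          exact h1.trans (by gcongr)
        _ = _ := by ring) 1 (by simp)
  simpa [gronwallBound_ε0_δ0] using key

lemma ContDiffAt.continuousAt_norm {V : Type*} [NormedAddCommGroup V] [NormedSpace ℝ V]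
    {n : WithTop ℕ∞} {φ : E → V} {z : E} (h : ContDiffAt ℝ n φ z) :
    ContinuousAt (fun w ↦ ‖φ w‖) z := h.continuousAt.norm

namespace LocalMetric

lemma apply_sq_le {b : E →L[ℝ] E →L[ℝ] ℝ} (hsymm : ∀ u v, b u v = b v u)
    (hb : ∀ u, 0 ≤ b u u) (u v : E) : b u v ^ 2 ≤ b u u * b v v :=
  LinearMap.BilinForm.apply_sq_le_of_symm
    (LinearMap.mk₂ ℝ (fun x y ↦ b x y) (by simp) (by simp) (by simp) (by simp)) hb
    ⟨fun x y ↦ hsymm x y⟩ u v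

/-- Used with `X = ∇f`, `Y = ∇h` and `c = f`. Cauchy–Schwarz for `b X Y` and for `b Y u` each yield
a factor `√(b Y Y)`; their product is the full power of `b Y Y` that Grönwall requires. -/
lemma norm_smul_gradient_le {b : E →L[ℝ] E →L[ℝ] ℝ} (hsymm : ∀ u v, b u v = b v u)
    (hb : ∀ u, 0 ≤ b u u) (X Y : E) {c : ℝ} (hc : 0 < c) :
    ‖(2 * b X Y / c) • b Y‖ ≤ 2 * √(b X X * ‖b‖) / c * ‖b Y Y‖ := by
  have hX := hb X
  have hY := hb Y
  refine ContinuousLinearMap.opNorm_le_bound _ (by positivity) fun u ↦ ?_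
  have h1 : b u u ≤ ‖b‖ * ‖u‖ ^ 2 := by
    have := (le_abs_self _).trans (b.le_opNorm₂ u u)
    rwa [mul_assoc, ← sq] at this
  have h2 : |b X Y * b Y u| ≤ √(b X X * ‖b‖) * (b Y Y * ‖u‖) := by
    rw [← Real.sqrt_sq (by positivity : 0 ≤ b Y Y * ‖u‖), ← Real.sqrt_mul (by positivity)]
    refine Real.abs_le_sqrt ?_
    calc (b X Y * b Y u) ^ 2 = b X Y ^ 2 * b Y u ^ 2 := by ring
      _ ≤ (b X X * b Y Y) * (b Y Y * (‖b‖ * ‖u‖ ^ 2)) := by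
        gcongr
        · exact apply_sq_le hsymm hb X Y
        · exact (apply_sq_le hsymm hb Y u).trans (by gcongr)
      _ = _ := by ring
  rw [Real.norm_of_nonneg hY, smul_apply, smul_eq_mul, Real.norm_eq_abs,
    show 2 * b X Y / c * b Y u = 2 / c * (b X Y * b Y u) by ring, abs_mul,
    abs_of_pos (by positivity : 0 < 2 / c)]
  calc _ ≤ 2 / c * (√(b X X * ‖b‖) * (b Y Y * ‖u‖)) := by gcongr
    _ = _ := by ring

end LocalMetric

end Local

/-! ### The critical set of a function on a Riemannian manifold. -/

section Charts

variable {E : Type*} [NormedAddCommGroup E] [NormedSpace ℝ E]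
  {H : Type*} [TopologicalSpace H] {I : ModelWithCorners ℝ E H}
  {M : Type*} [TopologicalSpace M] [ChartedSpace H M] [IsManifold I ∞ M]

namespace SemiRiemannianMetric

variable {g : SemiRiemannianMetric I M}

/-- Only semidefiniteness is claimed: `z` is arbitrary, and the derivative of the inverse chart may
have a kernel outside the target. -/
lemma IsRiemannian.inChart_nonneg (hg : g.IsRiemannian) (x : M) (z u : E) :
    0 ≤ g.inChart x z u u := by
  rw [inChart_apply]
  by_cases h : mfderiv 𝓘(ℝ, E) I (extChartAt I x).symm z u = 0
  · rw [h, map_zero]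
  · exact (hg _ _ h).le

lemma IsRiemannian.mfderiv_eq_zero [FiniteDimensional ℝ E] (hg : g.IsRiemannian) {k : M → ℝ}
    {x : M} (h : g.gradientProduct k k x = 0) : mfderiv I 𝓘(ℝ, ℝ) k x = 0 := by
  have h1 : g.gradient k x = 0 := by
    by_contra h2
    have := hg x _ h2
    rw [inner_gradient] at this
    exact this.ne' h
  ext v
  rw [← inner_gradient g, h1, map_zero]
  rfl

end SemiRiemannianMetric

variable [I.Boundaryless]

/-- An identity `dq = c dk` holds in every chart if it holds at the centre of each chart. -/
lemma hasFDerivAt_of_forall_center {q k : M → ℝ} (hk : ContMDiff I 𝓘(ℝ, ℝ) ∞ k) {c : M → ℝ}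
    (h : ∀ x, HasFDerivAt (q ∘ (extChartAt I x).symm)
      (c x • fderiv ℝ (k ∘ (extChartAt I x).symm) (extChartAt I x x)) (extChartAt I x x))
    {x : M} {z : E} (hz : z ∈ (extChartAt I x).target) :
    HasFDerivAt (q ∘ (extChartAt I x).symm)
      (c ((extChartAt I x).symm z) • fderiv ℝ (k ∘ (extChartAt I x).symm) z) z := by
  set x' := (extChartAt I x).symm z
  have hT : DifferentiableAt ℝ (extChartAt I x' ∘ (extChartAt I x).symm) z := by
    have h1 : ContMDiffAt I 𝓘(ℝ, E) ∞ (extChartAt I x') ((extChartAt I x).symm z) :=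
      contMDiffAt_extChartAt
    exact (h1.comp z (contMDiffAt_extChartAt_symm I hz)).contDiffAt.differentiableAt (by simp)
  have hev (l : M → ℝ) : l ∘ (extChartAt I x).symm =ᶠ[nhds z] (l ∘ (extChartAt I x').symm) ∘
      (extChartAt I x' ∘ (extChartAt I x).symm) := by
    have h1 := (contMDiffAt_extChartAt_symm I hz).continuousAt.eventually
      (extChartAt_source_mem_nhds (I := I) x')
    filter_upwards [h1] with w hw
    simp [-extChartAt, (extChartAt I x').left_inv hw]
  have hkc := (contDiffAt_comp_extChartAt_symm hk
    (mem_extChartAt_target (I := I) x')).differentiableAt (by simp)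
  -- Both differentials transform by the same transition derivative, so the scalar factor at `x'` is
  -- unchanged.
  have h1 := ((h x').comp z hT.hasFDerivAt).congr_of_eventuallyEq (hev q)
  have h2 := (hkc.hasFDerivAt.comp z hT.hasFDerivAt).congr_of_eventuallyEq (hev k)
  rw [h2.fderiv]
  exact h1

namespace SemiRiemannianMetric

variable (g : SemiRiemannianMetric I M)

/-- Tangent vectors at `x` are read in the chart at `x`, whose inverse has identity derivative at
the centre. -/
lemma inChart_self (x : M) : g.inChart x (extChartAt I x x) = g.innerModel x := by
  have h1 (y : M) (hy : y = x) : g.innerModel y = g.innerModel x := by rw [hy]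
  ext u v
  rw [inChart_apply, mfderiv_extChartAt_symm_self]
  exact congr($(h1 _ (extChartAt_to_inv (I := I) x)) u v)

variable {g}

/-- If `f d|∇h|² = 2 ⟨∇f, ∇h⟩ dh` with `f > 0`, then the set of critical points of `h` is open. -/
lemma IsRiemannian.eventually_gradientProduct_eq_zero [FiniteDimensional ℝ E]
    (hg : g.IsRiemannian) {f h : M → ℝ}
    (hf : ContMDiff I 𝓘(ℝ, ℝ) ∞ f) (hh : ContMDiff I 𝓘(ℝ, ℝ) ∞ h) (hpos : ∀ x, 0 < f x)
    (hder : ∀ x, HasFDerivAt (g.gradientProduct h h ∘ (extChartAt I x).symm)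
      ((2 * g.gradientProduct f h x / f x) •
        fderiv ℝ (h ∘ (extChartAt I x).symm) (extChartAt I x x)) (extChartAt I x x))
    {x : M} (hx : g.gradientProduct h h x = 0) :
    ∀ᶠ y in nhds x, g.gradientProduct h h y = 0 := by
  have htgt := (isOpen_extChartAt_target (I := I) x).mem_nhds (mem_extChartAt_target x)
  have hz₀ := mem_extChartAt_target (I := I) x
  have hfm := hf.mdifferentiable (by simp)
  have hhm := hh.mdifferentiable (by simp)
  -- This is `2 |∇f| √‖G‖ / f`; the factor `√‖G‖` compares the metric norm with the norm of the
  -- model space.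
  let C : E → ℝ := fun z ↦ 2 * √((g.gradientProduct f f ∘ (extChartAt I x).symm) z *
    ‖g.inChart x z‖) / (f ∘ (extChartAt I x).symm) z
  have hC : ContinuousAt C (extChartAt I x x) := by
    have h1 := (g.contDiffAt_gradientProduct hf hf hz₀).continuousAt
    have h2 : ContinuousAt (fun z ↦ ‖g.inChart x z‖) (extChartAt I x x) :=
      (g.contDiffAt_inChart hz₀).continuousAt_norm
    have h3 := (contDiffAt_comp_extChartAt_symm hf hz₀).continuousAt
    exact ((h1.mul h2).sqrt.const_mul 2).div h3 (hpos _).ne'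
  have key := eventually_eq_zero_of_norm_fderiv_le hC
    (q := g.gradientProduct h h ∘ (extChartAt I x).symm)
    (by
      filter_upwards [htgt] with z hz
      exact (hasFDerivAt_of_forall_center hh hder hz).differentiableAt)
    (by
      filter_upwards [htgt] with z hz
      rw [(hasFDerivAt_of_forall_center hh hder hz).fderiv]
      simp only [C, Function.comp_apply, g.gradientProduct_extChartAt_symm hfm hfm hz,
        g.gradientProduct_extChartAt_symm hfm hhm hz, g.gradientProduct_extChartAt_symm hhm hhm hz,
        ← g.inChart_gradientInChart _ hz]
      exact LocalMetric.norm_smul_gradient_le (g.inChart_symm x z) (hg.inChart_nonneg x z) _ _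
        (hpos _))
    (by rw [Function.comp_apply, extChartAt_to_inv, hx])
  have h1 := (continuousAt_extChartAt (I := I) x).eventually key
  filter_upwards [h1, extChartAt_source_mem_nhds (I := I) x] with y hy hys
  rwa [Function.comp_apply, (extChartAt I x).left_inv hys] at hy

end SemiRiemannianMetric

/-- A function on a connected manifold with vanishing differential is constant. -/
lemma exists_eq_const_of_mfderiv_eq_zero [ConnectedSpace M] {k : M → ℝ}
    (hk : ContMDiff I 𝓘(ℝ, ℝ) ∞ k) (h : ∀ x, mfderiv I 𝓘(ℝ, ℝ) k x = 0) :
    ∃ c : ℝ, ∀ x, k x = c := by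
  have hloc : IsLocallyConstant k := by
    rw [IsLocallyConstant.iff_eventually_eq]
    intro x
    have hz₀ := mem_extChartAt_target (I := I) x
    have h1 := eventually_eq_zero_of_norm_fderiv_le (C := fun _ ↦ 0) (z₀ := extChartAt I x x)
      (q := fun z ↦ (k ∘ (extChartAt I x).symm) z - k x) continuousAt_const
      (by
        filter_upwards [(isOpen_extChartAt_target (I := I) x).mem_nhds hz₀] with z hz
        exact ((contDiffAt_comp_extChartAt_symm hk hz).differentiableAt (by simp)).sub_const _)
      (by
        filter_upwards [(isOpen_extChartAt_target (I := I) x).mem_nhds hz₀] with z hz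
        rw [fderiv_sub_const, zero_mul, norm_le_zero_iff]
        ext u
        rw [fderiv_comp_extChartAt_symm hz (hk.mdifferentiable (by simp) _), h]
        rfl)
      (by simp [-extChartAt, extChartAt_to_inv])
    filter_upwards [(continuousAt_extChartAt (I := I) x).eventually h1,
      extChartAt_source_mem_nhds (I := I) x] with y hy hys
    rwa [Function.comp_apply, (extChartAt I x).left_inv hys, sub_eq_zero] at hy
  obtain ⟨x₀⟩ := (inferInstance : Nonempty M)
  exact ⟨k x₀, fun x ↦ hloc.apply_eq_of_preconnectedSpace x x₀⟩

/-- On a compact connected Riemannian manifold, a function `h` such that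
`f d|∇h|² = 2 ⟨∇f, ∇h⟩ dh` for some `f > 0` is constant. -/
theorem SemiRiemannianMetric.IsRiemannian.exists_eq_const [FiniteDimensional ℝ E] [CompactSpace M]
    [ConnectedSpace M] {g : SemiRiemannianMetric I M} (hg : g.IsRiemannian) {f h : M → ℝ}
    (hf : ContMDiff I 𝓘(ℝ, ℝ) ∞ f) (hh : ContMDiff I 𝓘(ℝ, ℝ) ∞ h) (hpos : ∀ x, 0 < f x)
    (hder : ∀ x, HasFDerivAt (g.gradientProduct h h ∘ (extChartAt I x).symm)
      ((2 * g.gradientProduct f h x / f x) •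
        fderiv ℝ (h ∘ (extChartAt I x).symm) (extChartAt I x x)) (extChartAt I x x)) :
    ∃ c : ℝ, ∀ x, h x = c := by
  have hhm := hh.mdifferentiable (n := ∞) (by simp)
  have hcont : Continuous (g.gradientProduct h h) := by
    rw [continuous_iff_continuousAt]
    intro x
    have h1 := (g.contDiffAt_gradientProduct hh hh (mem_extChartAt_target x)).continuousAt.comp
      (continuousAt_extChartAt (I := I) x)
    refine h1.congr ?_
    filter_upwards [extChartAt_source_mem_nhds (I := I) x] with y hy
    simp only [Function.comp_apply, (extChartAt I x).left_inv hy]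
  have hclopen : IsClopen {x | g.gradientProduct h h x = 0} :=
    ⟨isClosed_eq hcont continuous_const, isOpen_iff_mem_nhds.2 fun x hx ↦
      hg.eventually_gradientProduct_eq_zero hf hh hpos hder hx⟩
  -- A maximum of `h` supplies the critical point that makes the clopen set nonempty.
  obtain ⟨x₀, -, hmax⟩ := isCompact_univ.exists_isMaxOn univ_nonempty hh.continuous.continuousOn
  have hx₀ : g.gradientProduct h h x₀ = 0 := by
    have h1 : IsLocalMax (h ∘ (extChartAt I x₀).symm) (extChartAt I x₀ x₀) :=
      Filter.Eventually.of_forall fun z ↦ by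
        simpa only [Function.comp_apply, extChartAt_to_inv, mem_ofPred_eq] using hmax (mem_univ _)
    have h2 := g.gradientProduct_extChartAt_symm hhm hhm (mem_extChartAt_target (I := I) x₀)
    rwa [extChartAt_to_inv, h1.fderiv_eq_zero] at h2
  have huniv := hclopen.eq_univ ⟨x₀, hx₀⟩
  exact exists_eq_const_of_mfderiv_eq_zero hh fun x ↦
    hg.mfderiv_eq_zero (huniv.symm ▸ mem_univ x : x ∈ {x | g.gradientProduct h h x = 0})

end Charts

/-! ### From the Hessian equation on the warped product to the base. -/

section Warped

variable {E : Type*} [NormedAddCommGroup E] [NormedSpace ℝ E]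
  {H : Type*} [TopologicalSpace H] {I : ModelWithCorners ℝ E H} [I.Boundaryless]
  {B : Type*} [TopologicalSpace B] [ChartedSpace H B] [IsManifold I ∞ B]
  {E' : Type*} [NormedAddCommGroup E'] [NormedSpace ℝ E']
  {H' : Type*} [TopologicalSpace H'] {J : ModelWithCorners ℝ E' H'} [J.Boundaryless]
  {F : Type*} [TopologicalSpace F] [ChartedSpace H' F] [IsManifold J ∞ F]

variable (I J) in
-- The inverse product chart followed by the projection is the inverse chart of the base after the
-- linear projection; the chain rule is applied to both factorisations.
lemma mfderiv_fst_extChartAt_symm (p : B × F) {z : E × E'}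
    (hz : z ∈ (extChartAt (I.prod J) p).target) (u : E × E') :
    mfderiv (I.prod J) I Prod.fst ((extChartAt (I.prod J) p).symm z)
      (mfderiv 𝓘(ℝ, E × E') (I.prod J) (extChartAt (I.prod J) p).symm z u) =
      mfderiv 𝓘(ℝ, E) I (extChartAt I p.1).symm z.1 u.1 := by
  have h0 : z.1 ∈ (extChartAt I p.1).target := by
    rw [extChartAt_prod] at hz
    exact hz.1
  have h1 := mfderiv_comp z (mdifferentiableAt_fst (I := I) (I' := J))
    ((contMDiffAt_extChartAt_symm (I.prod J) hz).mdifferentiableAt (by simp))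
  have h2 := (((contMDiffAt_extChartAt_symm I h0).mdifferentiableAt
    (by simp)).hasMFDerivAt.comp z
      (hasFDerivAt_fst (𝕜 := ℝ) (p := z)).hasMFDerivAt).mfderiv
  have h3 : Prod.fst ∘ (extChartAt (I.prod J) p).symm = (extChartAt I p.1).symm ∘ Prod.fst := by
    rw [extChartAt_prod]
    rfl
  have h4 (k : E × E' → B) (hk : k = (extChartAt I p.1).symm ∘ Prod.fst) :
      mfderiv 𝓘(ℝ, E × E') I k z u = mfderiv 𝓘(ℝ, E) I (extChartAt I p.1).symm z.1 u.1 := by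
    subst hk
    exact DFunLike.congr_fun h2 u
  exact (DFunLike.congr_fun h1.symm u).trans (h4 _ h3)

variable (I J) in
lemma mfderiv_snd_extChartAt_symm (p : B × F) {z : E × E'}
    (hz : z ∈ (extChartAt (I.prod J) p).target) (u : E × E') :
    mfderiv (I.prod J) J Prod.snd ((extChartAt (I.prod J) p).symm z)
      (mfderiv 𝓘(ℝ, E × E') (I.prod J) (extChartAt (I.prod J) p).symm z u) =
      mfderiv 𝓘(ℝ, E') J (extChartAt J p.2).symm z.2 u.2 := by
  have h0 : z.2 ∈ (extChartAt J p.2).target := by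
    rw [extChartAt_prod] at hz
    exact hz.2
  have h1 := mfderiv_comp z (mdifferentiableAt_snd (I := I) (I' := J))
    ((contMDiffAt_extChartAt_symm (I.prod J) hz).mdifferentiableAt (by simp))
  have h2 := (((contMDiffAt_extChartAt_symm J h0).mdifferentiableAt
    (by simp)).hasMFDerivAt.comp z
      (hasFDerivAt_snd (𝕜 := ℝ) (p := z)).hasMFDerivAt).mfderiv
  have h3 : Prod.snd ∘ (extChartAt (I.prod J) p).symm = (extChartAt J p.2).symm ∘ Prod.snd := by
    rw [extChartAt_prod]
    rfl
  have h4 (k : E × E' → F) (hk : k = (extChartAt J p.2).symm ∘ Prod.snd) :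
      mfderiv 𝓘(ℝ, E × E') J k z u = mfderiv 𝓘(ℝ, E') J (extChartAt J p.2).symm z.2 u.2 := by
    subst hk
    exact DFunLike.congr_fun h2 u
  exact (DFunLike.congr_fun h1.symm u).trans (h4 _ h3)

namespace SemiRiemannianMetric

variable (gB : SemiRiemannianMetric I B) (gF : SemiRiemannianMetric J F) {f : B → ℝ}
  (hf : ContMDiff I 𝓘(ℝ, ℝ) ∞ f) (hpos : ∀ x, 0 < f x)

lemma inChart_warpedProduct (p : B × F) {z : E × E'}
    (hz : z ∈ (extChartAt (I.prod J) p).target) (u v : E × E') :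
    (gB.warpedProduct gF f hf hpos).inChart p z u v = gB.inChart p.1 z.1 u.1 v.1 +
      (f ∘ (extChartAt I p.1).symm) z.1 ^ 2 * gF.inChart p.2 z.2 u.2 v.2 := by
  rw [inChart_apply, inChart_apply, inChart_apply, ← mfderiv_fst_extChartAt_symm I J p hz,
    ← mfderiv_fst_extChartAt_symm I J p hz, ← mfderiv_snd_extChartAt_symm I J p hz,
    ← mfderiv_snd_extChartAt_symm I J p hz]
  rfl

/-- If the Hessian of a function `h` on the base of a warped product is pointwise proportional to
the metric of the warped product, then `f d|∇h|² = 2 ⟨∇f, ∇h⟩ dh` on the base. -/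
lemma hasFDerivAt_gradientProduct_of_hessian_eq [FiniteDimensional ℝ E] [FiniteDimensional ℝ E']
    [Nontrivial E'] {h : B → ℝ} (hh : ContMDiff I 𝓘(ℝ, ℝ) ∞ h) (p : B × F) {ψ : ℝ}
    (hess : ∀ u v, ψ * (gB.warpedProduct gF f hf hpos).inner p u v =
      (gB.warpedProduct gF f hf hpos).hessian (fun p ↦ h p.1) p u v) :
    HasFDerivAt (gB.gradientProduct h h ∘ (extChartAt I p.1).symm)
      ((2 * gB.gradientProduct f h p.1 / f p.1) •
        fderiv ℝ (h ∘ (extChartAt I p.1).symm) (extChartAt I p.1 p.1)) (extChartAt I p.1 p.1) := by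
  set W := gB.warpedProduct gF f hf hpos
  set k := h ∘ (extChartAt I p.1).symm
  set r := f ∘ (extChartAt I p.1).symm with hr
  set X := gB.gradientInChart h p.1
  have hzB := mem_extChartAt_target (I := I) p.1
  have hzW := mem_extChartAt_target (I := I.prod J) p
  have hBev := (isOpen_extChartAt_target (I := I) p.1).mem_nhds hzB
  have hWev := (isOpen_extChartAt_target (I := I.prod J) p).mem_nhds hzW
  have hz₀ : extChartAt (I.prod J) p p = (extChartAt I p.1 p.1, extChartAt J p.2 p.2) := by
    rw [extChartAt_prod]
    rfl
  have hess' (u v : E × E') : ψ * W.inChart p (extChartAt (I.prod J) p p) u v =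
      LocalMetric.hessian (W.inChart p) (fun z ↦ k z.1) (extChartAt (I.prod J) p p) u v := by
    have h1 : (fun p : B × F ↦ h p.1) ∘ (extChartAt (I.prod J) p).symm = fun z ↦ k z.1 := by
      rw [extChartAt_prod]
      rfl
    rw [inChart_self, ← h1]
    exact hess u v
  have hG : DifferentiableAt ℝ (W.inChart p) (extChartAt (I.prod J) p p) :=
    (W.contDiffAt_inChart hzW).differentiableAt (by simp)
  have hGe : ∀ᶠ z in nhds (extChartAt (I.prod J) p p), ∀ u v, W.inChart p z u v =
      gB.inChart p.1 z.1 u.1 v.1 + r z.1 ^ 2 * gF.inChart p.2 z.2 u.2 v.2 :=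
    Filter.eventually_of_mem hWev fun z hz ↦ inChart_warpedProduct gB gF hf hpos p hz
  have hinv := W.isInvertible_inChart hzW
  have hsymm := W.inChart_symm p (extChartAt (I.prod J) p p)
  have hkd : ∀ᶠ z in nhds (extChartAt I p.1 p.1), DifferentiableAt ℝ k z :=
    Filter.eventually_of_mem hBev fun z hz ↦
      (contDiffAt_comp_extChartAt_symm hh hz).differentiableAt (by simp)
  have hk2 : DifferentiableAt ℝ (fderiv ℝ k) (extChartAt I p.1 p.1) :=
    ((contDiffAt_comp_extChartAt_symm hh hzB).fderiv_right (m := ∞) (by simp)).differentiableAt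
      (by simp)
  have hrd : DifferentiableAt ℝ r (extChartAt I p.1 p.1) :=
    (contDiffAt_comp_extChartAt_symm hf hzB).differentiableAt (by simp)
  have hXd : DifferentiableAt ℝ X (extChartAt I p.1 p.1) :=
    (gB.contDiffAt_gradientInChart hh hzB).differentiableAt (by simp)
  have hr₀ : r (extChartAt I p.1 p.1) = f p.1 := by
    rw [hr, Function.comp_apply, extChartAt_to_inv]
  have hfp := (hpos p.1).ne'
  -- A nonzero vertical vector and nondegeneracy give a pair with nonzero product; `a` itself may be
  -- null, since `gF` can be indefinite.
  obtain ⟨a, ha⟩ := exists_ne (0 : E')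
  obtain ⟨b, hab⟩ : ∃ b, gF.inChart p.2 (extChartAt J p.2 p.2) a b ≠ 0 := by
    by_contra! hab
    rw [inChart_self] at hab
    exact ha (gF.nondegenerate p.2 a hab)
  rw [hz₀] at hess' hG hGe hinv hsymm
  have hψ : ψ = gB.gradientProduct f h p.1 / f p.1 := by
    -- With the squared warping function this reads `ψ f² = d(f²)(∇h) / 2 = f ⟨∇f, ∇h⟩`; one factor
    -- `f` cancels.
    have h1 := LocalMetric.warped_factor hG hinv hsymm hGe (r := fun z ↦ r z ^ 2) (hrd.pow 2)
      hkd hk2 (gB.inChart_gradientInChart h hzB) hess' hab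
    have h2 := gB.gradientProduct_extChartAt_symm (hf.mdifferentiable (by simp))
      (hh.mdifferentiable (by simp)) hzB
    rw [extChartAt_to_inv] at h2
    have h3 : HasFDerivAt (fun z ↦ r z ^ 2) _ (extChartAt I p.1 p.1) :=
      (hrd.hasFDerivAt.mul hrd.hasFDerivAt).congr_of_eventuallyEq (.of_forall fun z ↦ sq (r z))
    rw [h3.fderiv, hr₀, add_apply, smul_apply, smul_eq_mul] at h1
    rw [h2, eq_div_iff hfp]
    apply mul_right_cancel₀ hfp
    linarith
  have h1 := LocalMetric.hasFDerivAt_normSq_gradient_of_warped hG hinv hsymm hGe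
    (r := fun z ↦ r z ^ 2) hkd hk2 hXd
    (Filter.eventually_of_mem hBev fun z hz ↦ gB.inChart_gradientInChart h hz) hess'
  rw [hψ, ← mul_div_assoc] at h1
  exact h1.congr_of_eventuallyEq (Filter.eventually_of_mem hBev fun z hz ↦
    gB.gradientProduct_extChartAt_symm (hh.mdifferentiable (by simp))
      (hh.mdifferentiable (by simp)) hz)

end SemiRiemannianMetric

end Warped

/-! ### The theorem. -/

theorem mainTheorem1 {n d : ℕ} (hd : 1 ≤ d)
    {B : Type*} [TopologicalSpace B] [T2Space B] [CompactSpace B] [ConnectedSpace B]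
    [ChartedSpace (EuclideanSpace ℝ (Fin n)) B] [IsManifold (𝓡 n) ∞ B]
    {F : Type*} [TopologicalSpace F] [T2Space F] [Nonempty F]
    [ChartedSpace (EuclideanSpace ℝ (Fin d)) F] [IsManifold (𝓡 d) ∞ F]
    (gB : SemiRiemannianMetric (𝓡 n) B) (hgB : gB.IsRiemannian)
    (gF : SemiRiemannianMetric (𝓡 d) F) (lambdaF : ℝ)
    (hF : ∀ y, gF.scalarCurvature y = lambdaF)
    (f : B → ℝ) (hf : ContMDiff (𝓡 n) 𝓘(ℝ, ℝ) ∞ f) (hpos : ∀ x, 0 < f x)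
    (h : B → ℝ) (hh : ContMDiff (𝓡 n) 𝓘(ℝ, ℝ) ∞ h) (ρ : ℝ)
    (hsol : (gB.warpedProduct gF f hf hpos).IsGradientYamabeSoliton
      (fun p : B × F ↦ h p.1) ρ) :
    ∃ c : ℝ, ∀ x : B, h x = c := by
  obtain ⟨y⟩ := (inferInstance : Nonempty F)
  -- This makes the model space of the fibre nontrivial, so that vertical directions exist.
  have : Nonempty (Fin d) := ⟨⟨0, hd⟩⟩
  -- A single slice `B × {y}` suffices, with `ψ` the value of `S - ρ` at `(x, y)`.
  exact hgB.exists_eq_const hf hh hpos fun x ↦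
    gB.hasFDerivAt_gradientProduct_of_hessian_eq gF hf hpos hh (x, y) (hsol.2 (x, y))
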